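/- For $n\ge 0$ let $Q_n$ be the hypercube: the graph on $\{0,1\}^n$ in which two vertices are adjacent if they differ in exactly one coordinate. Let $e(Q_n)$ be its number of edges, and let $\mathrm{ex}(Q_n,H)$ be the maximum number of edges in a subgraph of $Q_n$ that contains no copy of $H$. The non-zero bits of an edge of $Q_l$ are the coordinates $i\in[l]$ at which at least one of its two ends has a $1$. A hypergraph $\mathcal H$ on the vertex set $[l]$ is a $k$-partite representation of a graph $G$ if $G$ is isomorphic to a subgraph $H$ of $Q_l$ such that every edge of $H$ has exactly $k$ non-zero bits, there is a function $\sigma:[l]\to[k]$ that maps the set of non-zero bits of each edge of $H$ onto $[k]$, and the edges of $\mathcal H$ are exactly the sets of non-zero bits of the edges of $H$. Then the following hold. 1. For every $t\ge 4$ with $t\ne 5$, $\mathrm{ex}(Q_n,C_{2t})=o(e(Q_n))$ as $n\to\infty$. 2. For every even $t\ge 4$, the graph cycle $C_t$ (as a $2$-uniform hypergraph on $[t]$) is a $2$-partite representation of $C_{2t}$. 3. For every odd $t\ge 7$, $C_{2t}$ has a $3$-partite representation $\mathcal H$ on the vertex set $[t]$ that is close to a tight cycle, in the following sense: $\mathcal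 H$ has exactly $t$ edges, and at least $t-2$ of them are edges of the $3$-uniform tight cycle on $[t]$, whose edges are the triples $\{i,i+1,i+2\}$ with indices modulo $t$. If moreover $3\mid t$, then $\mathcal H$ can be taken to be the tight cycle itself. -/

import Mathlib

open Asymptotics Filter

/-- The hypercube `Q_n`: the graph on `{0,1}^n` in which two vertices are adjacent if they differ
in exactly one coordinate. -/
def cube (n : ℕ) : SimpleGraph (Fin n → Bool) where
  Adj u v := ∃! i, u i ≠ v i
  symm := ⟨fun _ _ ⟨i, hi, h⟩ => ⟨i, hi.symm, fun j hj => h j hj.symm⟩⟩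
  loopless := ⟨fun _ ⟨_, hi, _⟩ => hi rfl⟩

/-- `ex(G, H)`: the maximum number of edges in a subgraph of `G` which contains no copy of `H`
(`H.Free G'` says that `G'` has no subgraph isomorphic to `H`). For `G` finite and `H` with at
least one edge the set below is nonempty and bounded, so the supremum is a maximum. -/
noncomputable def relativeEx {V W : Type*} (G : SimpleGraph V) (H : SimpleGraph W) : ℕ :=
  sSup {m : ℕ | ∃ G' : SimpleGraph V, G' ≤ G ∧ H.Free G' ∧ G'.edgeSet.ncard = m}

/-- The set of positions of the non-zero bits of an edge of the cube, that is, the positions of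
the ones together with the position of the flip-bit: those `i` at which at least one of the two
ends of the edge has a one. -/
def nonzeroBits {l : ℕ} (e : Sym2 (Fin l → Bool)) : Set (Fin l) :=
  {i | ∃ u ∈ e, u i = true}

/-- The hypergraph `{τ(e) : e ∈ E(H)}` on vertex set `[l]`, given by its set of edges. -/
def repHypergraph {l : ℕ} (H : (cube l).Subgraph) : Set (Set (Fin l)) :=
  nonzeroBits '' H.edgeSet

/-- The subgraph `H` of `Q_l` satisfies the conditions in the definition of a `k`-partite
representation: every edge has exactly `k` non-zero bits, and some `σ : [l] → [k]` maps the set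
of non-zero bits of every edge onto `[k]`. -/
def IsPartiteIn (k : ℕ) {l : ℕ} (H : (cube l).Subgraph) : Prop :=
  (∀ e ∈ H.edgeSet, (nonzeroBits e).ncard = k) ∧
    ∃ σ : Fin l → Fin k, ∀ e ∈ H.edgeSet, σ '' nonzeroBits e = Set.univ

/-- The hypergraph on `[l]` with edge set `𝓗` is a `k`-partite representation of the graph `G`:
`G` can be realised as a subgraph of `Q_l` which meets the conditions for a `k`-partite
representation and whose associated hypergraph is `𝓗`. -/
def IsPartiteRepresentation (k : ℕ) {W : Type*} (G : SimpleGraph W) {l : ℕ}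
    (𝓗 : Set (Set (Fin l))) : Prop :=
  ∃ H : (cube l).Subgraph, Nonempty (G ≃g H.coe) ∧ IsPartiteIn k H ∧ repHypergraph H = 𝓗

/-- The edge set of a graph, regarded as a `2`-uniform hypergraph. -/
def graphHypergraph {V : Type*} (G : SimpleGraph V) : Set (Set V) :=
  {s | ∃ u v, G.Adj u v ∧ s = {u, v}}

/-- The `3`-uniform tight cycle on `t` vertices, whose edges are the triples
`{i, i + 1, i + 2}` with addition modulo `t` (`finRotate t i` is `i + 1` modulo `t`). -/
def tightCycle (t : ℕ) : Set (Set (Fin t)) :=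
  Set.range fun i : Fin t => {i, finRotate t i, finRotate t (finRotate t i)}

/-!
The first assertion follows from the other two by Conlon's criterion
`IsPartiteRepresentation.relativeEx_isLittleO`: any graph `A` with a `k`-partite representation has
extremal number `o(e(Q_n))`. To see this, let `G` be a subgraph of `Q_n` with `ε e(Q_n)` edges. A
positive proportion of the vertices `T` has at least `ε n / 4` edges of `G` leading down to sets
`T \ {i}`, hence about `n ^ k` many `k`-tuples `K` of such directions `i`. As `(T, K)` is determined
by `(T \ K, K)`, averaging over the `2 ^ n` sets `S = T \ K` gives a single `S` to which a positive
proportion of all `k`-tuples belongs (`exists_linkTuples_dense`). By Erdős' theorem on `k`-partite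
`k`-uniform hypergraphs (`exists_box_of_dense`) these tuples contain a large box, and a copy of `A`
is found in `G` by adding `S` to the vertices of `A` and placing the coordinates of colour `c` on the
`c`-th side of the box (`isContained_of_box`).

The representations are given by cyclic sequences of `k`-sets on `[t]` in which consecutive sets
share a `(k - 1)`-set, these intersections being distinct; the sets and their intersections form a
cycle of length `2t` between two layers of the cube (`isPartiteRepresentation_cycleGraph`). With the
colouring by residues modulo `k`, the pairs `{i, i + 1}` (modulo `t`) do for `k = 2` and even `t`.
For `k = 3` the triples `{i, i + 1, i + 2}` do if `3 ∣ t`; otherwise the two triples of the tight cycle which run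
through the pair `{t - 1, 0}` are replaced by other triples with distinct colours.
-/

/-! ### Dense sets of tuples contain large boxes -/

/-- If the values of `f` on `s` are at most `B` and their mean is at least `2 * δ * B`, then a
proportion at least `δ` of them is at least `δ * B`. -/
theorem Finset.mul_card_le_card_filter_of_le_sum {α : Type*} (s : Finset α) (f : α → ℝ) {B δ : ℝ}
    (hB : 0 < B) (hδ : 0 ≤ δ) (hf : ∀ x ∈ s, f x ≤ B) (hs : 2 * δ * B * s.card ≤ ∑ x ∈ s, f x) :
    δ * s.card ≤ ((s.filter fun x => δ * B ≤ f x).card : ℝ) := by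
  have h : ∑ x ∈ s, f x ≤ ∑ x ∈ s, ((if δ * B ≤ f x then B else 0) + δ * B) := by
    refine Finset.sum_le_sum fun x hx => ?_
    have := hf x hx
    have := mul_nonneg hδ hB.le
    split_ifs <;> linarith
  rw [Finset.sum_add_distrib, ← Finset.sum_filter, Finset.sum_const, Finset.sum_const,
    nsmul_eq_mul, nsmul_eq_mul] at h
  refine le_of_mul_le_mul_right ?_ hB
  linarith

/-- Some fibre of a map `s → t` has at least the average size. -/
theorem Finset.exists_card_fiber_ge {α β : Type*} [DecidableEq β] (s : Finset α) (t : Finset β)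
    (f : α → β) (hf : ∀ x ∈ s, f x ∈ t) (ht : t.Nonempty) :
    ∃ b ∈ t, (s.card : ℝ) / t.card ≤ ((s.filter fun x => f x = b).card : ℝ) := by
  have ht' : (0 : ℝ) < t.card := by exact_mod_cast ht.card_pos
  refine Finset.exists_le_card_fiber_of_nsmul_le_card_of_maps_to hf ht ?_
  rw [nsmul_eq_mul, mul_div_cancel₀ _ ht'.ne']

/-- Erdős' theorem on complete `k`-partite `k`-uniform hypergraphs: a set of `k`-tuples of positive
density in `V ^ k` contains a product of `k` sets of size `l`, once `V` is large. -/
theorem exists_box_of_dense (k l : ℕ) {c : ℝ} (hc : 0 < c) :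
    ∃ M : ℕ, ∀ m ≥ M, ∀ F : Finset (Fin k → Fin m), c * (m : ℝ) ^ k ≤ F.card →
      ∃ a : Fin k → Fin l → Fin m, (∀ i, Function.Injective (a i)) ∧
        ∀ f : Fin k → Fin l, (fun i => a i (f i)) ∈ F := by
  classical
  induction k generalizing c with
  | zero =>
    refine ⟨0, fun m _ F hF => ⟨fun i => i.elim0, fun i => i.elim0, fun f => ?_⟩⟩
    have : 0 < F.card := by
      have : (0 : ℝ) < F.card := lt_of_lt_of_le (by simpa using hc) hF
      exact_mod_cast this
    obtain ⟨y, hy⟩ := Finset.card_pos.1 this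
    convert hy
  | succ k ih =>
    -- `R` first coordinates of large degree are enough: on average over the remaining
    -- coordinates at least `c / 2 * R > 2 * l` of them extend to a tuple in `F`.
    obtain ⟨R, hR⟩ := exists_nat_gt (4 * l / c)
    have hR0 : (0 : ℝ) < R := lt_of_le_of_lt (by positivity) hR
    have hRl : (l : ℝ) ≤ c / 4 * R := by
      rw [div_lt_iff₀ hc] at hR; linarith
    obtain ⟨M, hM⟩ := ih (c := c / 4 / 2 ^ R) (by positivity)
    -- For `m ≥ M₁` the `c / 2 * m` first coordinates of large degree are at least `R` in number.
    obtain ⟨M₁, hM₁⟩ := exists_nat_gt (R / (c / 2))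
    refine ⟨max M (max M₁ 1), fun m hm F hF => ?_⟩
    have hmM : M ≤ m := le_trans (le_max_left _ _) hm
    have hmM₁ : M₁ ≤ m := le_trans (le_trans (le_max_left _ _) (le_max_right _ _)) hm
    have hm1 : 1 ≤ m := le_trans (le_trans (le_max_right _ _) (le_max_right _ _)) hm
    have hm0 : (0 : ℝ) < m := by exact_mod_cast hm1
    have hmk : (0 : ℝ) < (m : ℝ) ^ k := by positivity
    let A : Fin m → Finset (Fin k → Fin m) := fun x =>
      Finset.univ.filter fun y => (Fin.cons x y : Fin (k + 1) → Fin m) ∈ F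
    have hA : ∑ x, ((A x).card : ℝ) = F.card := by
      have : F.card = ∑ x, (A x).card := by
        rw [Finset.card_eq_sum_card_fiberwise (f := fun y => y 0) (t := Finset.univ) (by simp)]
        refine Finset.sum_congr rfl fun x _ => ?_
        refine Finset.card_bij' (fun y _ => Fin.tail y) (fun y _ => Fin.cons x y) ?_ ?_ ?_ ?_
        · rintro y hy
          simp only [Finset.mem_filter] at hy
          simp only [A, Finset.mem_filter, Finset.mem_univ, true_and]
          rw [← hy.2, Fin.cons_self_tail]; exact hy.1
        · intro y hy
          simp only [A, Finset.mem_filter, Finset.mem_univ, true_and] at hy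
          simp [hy]
        · intro y hy
          simp only [Finset.mem_filter] at hy
          simp only [← hy.2, Fin.cons_self_tail]
        · intro y hy
          simp
      rw [this]; push_cast; rfl
    have hX := Finset.mul_card_le_card_filter_of_le_sum (Finset.univ : Finset (Fin m))
      (fun x => ((A x).card : ℝ)) (B := (m : ℝ) ^ k) (δ := c / 2) hmk (by positivity)
      (fun x _ => by
        have := Finset.card_le_univ (A x)
        rw [Fintype.card_fun, Fintype.card_fin, Fintype.card_fin] at this
        exact_mod_cast this)
      (by rw [hA, Finset.card_univ, Fintype.card_fin]; refine le_trans (le_of_eq ?_) hF; ring)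
    rw [Finset.card_univ, Fintype.card_fin] at hX
    obtain ⟨X, hXs, hXc⟩ := Finset.exists_subset_card_eq (n := R)
      (s := Finset.univ.filter fun x => c / 2 * (m : ℝ) ^ k ≤ ((A x).card : ℝ)) (by
        have h2 : (R : ℝ) ≤ c / 2 * m := by
          rw [div_lt_iff₀ (by positivity)] at hM₁
          have : (M₁ : ℝ) ≤ m := by exact_mod_cast hmM₁
          nlinarith
        exact_mod_cast h2.trans hX)
    let N : (Fin k → Fin m) → Finset (Fin m) := fun y =>
      X.filter fun x => (Fin.cons x y : Fin (k + 1) → Fin m) ∈ F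
    have hN : ∑ y, ((N y).card : ℝ) = ∑ x ∈ X, ((A x).card : ℝ) := by
      simp only [N, A, Finset.card_filter, Nat.cast_sum]
      rw [Finset.sum_comm]
    have hY := Finset.mul_card_le_card_filter_of_le_sum
      (Finset.univ : Finset (Fin k → Fin m))
      (fun y => ((N y).card : ℝ)) (B := R) (δ := c / 4) hR0 (by positivity)
      (fun y _ => by rw [← hXc]; exact_mod_cast Finset.card_filter_le _ _)
      (by
        rw [hN, Finset.card_univ, Fintype.card_fun, Fintype.card_fin, Fintype.card_fin]
        have : ∑ x ∈ X, c / 2 * (m : ℝ) ^ k ≤ ∑ x ∈ X, ((A x).card : ℝ) :=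
          Finset.sum_le_sum fun x hx => (Finset.mem_filter.1 (hXs hx)).2
        rw [Finset.sum_const, hXc, nsmul_eq_mul] at this
        push_cast
        linarith)
    rw [Finset.card_univ, Fintype.card_fun, Fintype.card_fin, Fintype.card_fin] at hY
    -- Each `y ∈ Y` extends by at least `l` elements of `X`; by pigeonhole over the `2 ^ R` subsets
    -- of `X`, a positive proportion of all `y` has the same set `L` of extensions.
    set Y := Finset.univ.filter fun y => c / 4 * R ≤ ((N y).card : ℝ)
    obtain ⟨L, hL, hLc⟩ := Finset.exists_card_fiber_ge Y X.powerset N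
      (fun y _ => Finset.mem_powerset.2 (Finset.filter_subset _ _)) ⟨∅, by simp⟩
    rw [Finset.card_powerset, hXc] at hLc
    push_cast at hLc hY
    have hfib : c / 4 / 2 ^ R * (m : ℝ) ^ k ≤ ((Y.filter fun y => N y = L).card : ℝ) := by
      refine le_trans ?_ hLc
      rw [div_mul_eq_mul_div]
      gcongr
    obtain ⟨a, ha, haF⟩ := hM m hmM _ hfib
    have hLl : l ≤ L.card := by
      have : (0 : ℝ) < ((Y.filter fun y => N y = L).card : ℝ) :=
        lt_of_lt_of_le (by positivity) hfib
      obtain ⟨y, hy⟩ := Finset.card_pos.1 (by exact_mod_cast this)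
      rw [Finset.mem_filter, Finset.mem_filter] at hy
      have := hRl.trans hy.1.2
      rw [hy.2] at this
      exact_mod_cast this
    refine ⟨Fin.cons (fun j => L.orderEmbOfCardLe hLl j) a, ?_, fun f => ?_⟩
    · intro i
      refine Fin.cases ?_ ?_ i
      · exact (L.orderEmbOfCardLe hLl).injective
      · exact ha
    · have h1 := haF fun i => f i.succ
      rw [Finset.mem_filter] at h1
      have h2 : L.orderEmbOfCardLe hLl (f 0) ∈ N fun i => a i (f i.succ) := by
        rw [h1.2]; exact L.orderEmbOfCardLe_mem hLl _
      have h3 := (Finset.mem_filter.1 h2).2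
      convert h3 using 1
      funext i
      refine Fin.cases ?_ ?_ i
      · rfl
      · intro i; rfl

/-! ### Counting edges of the cube by their top ends -/

/-- The directions `i` in which `G` has an edge from the vertex `T` of the cube down to `T \ {i}`. -/
noncomputable def downDirections {n : ℕ} (G : SimpleGraph (Fin n → Bool)) (T : Fin n → Bool) :
    Finset (Fin n) := by
  classical
  exact Finset.univ.filter fun i => T i = true ∧ G.Adj T (Function.update T i false)

theorem mem_downDirections {n : ℕ} {G : SimpleGraph (Fin n → Bool)} {T : Fin n → Bool}
    {i : Fin n} :
    i ∈ downDirections G T ↔ T i = true ∧ G.Adj T (Function.update T i false) := by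
  simp [downDirections]

/-- Adjacent vertices of the cube are a set and that set with one element removed. -/
theorem cube_adj_iff {n : ℕ} {u v : Fin n → Bool} : (cube n).Adj u v ↔
    (∃ i, u i = true ∧ v = Function.update u i false) ∨
      ∃ i, v i = true ∧ u = Function.update v i false := by
  have key : ∀ {u v : Fin n → Bool} {i : Fin n}, u i ≠ v i → (∀ j, u j ≠ v j → j = i) →
      u i = true → v = Function.update u i false := by
    intro u v i hi hu ht
    funext j
    by_cases hj : j = i
    · subst hj
      rw [ht] at hi
      simpa using hi.symm
    · rw [Function.update_of_ne hj]
      by_contra h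
      exact hj (hu j fun h' => h h'.symm)
  constructor
  · rintro ⟨i, hi, hu⟩
    cases h : u i
    · right
      have hv : v i = true := by simpa [h] using hi.symm
      exact ⟨i, hv, key (fun h' => hi h'.symm) (fun j hj => hu j fun h' => hj h'.symm) hv⟩
    · left
      exact ⟨i, h, key hi hu h⟩
  · rintro (⟨i, hi, rfl⟩ | ⟨i, hi, rfl⟩) <;>
    · refine ⟨i, by simp [hi], fun j hj => ?_⟩
      by_contra h
      simp [Function.update_of_ne h] at hj

theorem sum_card_downDirections {n : ℕ} {G : SimpleGraph (Fin n → Bool)} (hG : G ≤ cube n) :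
    ∑ T, (downDirections G T).card = G.edgeSet.ncard := by
  classical
  rw [← Finset.card_sigma, Set.ncard_eq_toFinset_card']
  refine Finset.card_bij (fun p _ => s(p.1, Function.update p.1 p.2 false)) ?_ ?_ ?_
  · rintro ⟨T, i⟩ h
    rw [Finset.mem_sigma, mem_downDirections] at h
    simpa using h.2.2
  · rintro ⟨T, i⟩ h ⟨U, j⟩ h' he
    rw [Finset.mem_sigma, mem_downDirections] at h h'
    obtain ⟨-, hi, -⟩ := h
    obtain ⟨-, hj, -⟩ := h'
    dsimp only at hi hj he
    rw [Sym2.eq_iff] at he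
    rcases he with ⟨rfl, he⟩ | ⟨h1, h2⟩
    · have : j = i := by
        by_contra hne
        have := congrFun he j
        simp [Function.update_of_ne hne, hj] at this
      rw [this]
    · exfalso
      have e1 := congrFun h1 j
      have e2 := congrFun h2 j
      rw [Function.update_self] at e1
      rw [hj, Function.update_apply] at e2
      split_ifs at e2
      rw [e1] at e2; exact Bool.false_ne_true e2
  · intro e
    induction e with
    | h u v =>
      intro h
      have h : G.Adj u v := by simpa using h
      rcases cube_adj_iff.1 (hG h) with ⟨i, hi, rfl⟩ | ⟨i, hi, rfl⟩
      · exact ⟨⟨u, i⟩, by simp [mem_downDirections, hi, h], rfl⟩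
      · exact ⟨⟨v, i⟩, by simp [mem_downDirections, hi, h.symm], Sym2.eq_swap⟩

theorem two_mul_ncard_edgeSet_cube (n : ℕ) : 2 * (cube n).edgeSet.ncard = n * 2 ^ n := by
  classical
  have hD : ∀ T : Fin n → Bool,
      (downDirections (cube n) T).card = (Finset.univ.filter fun i => T i = true).card := by
    intro T
    congr 1
    ext i
    rw [mem_downDirections, Finset.mem_filter]
    exact ⟨fun h => ⟨Finset.mem_univ _, h.1⟩,
      fun h => ⟨h.2, cube_adj_iff.2 (Or.inl ⟨i, h.2, rfl⟩)⟩⟩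
  rw [← sum_card_downDirections le_rfl, two_mul]
  have hnot : Function.Involutive fun (T : Fin n → Bool) i => !T i := fun T => by simp
  -- Complementation pairs up the vertices so that the two down-degrees add up to `n`.
  nth_rewrite 1 [← Equiv.sum_comp (hnot.toPerm _) fun T => (downDirections (cube n) T).card]
  rw [← Finset.sum_add_distrib, Finset.sum_congr rfl (g := fun _ => n)]
  · simp [mul_comm]
  · intro T _
    rw [hD, hD, add_comm]
    simpa [Function.Involutive.toPerm] using
      Finset.card_filter_add_card_filter_not (s := (Finset.univ : Finset (Fin n)))
        (fun i => T i = true)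

/-! ### Dense subgraphs of the cube -/

/-- The vertex `S ∪ {K c : c}` of the cube. -/
noncomputable def addRange {n k : ℕ} (S : Fin n → Bool) (K : Fin k → Fin n) : Fin n → Bool := by
  classical
  exact fun j => S j || decide (j ∈ Set.range K)

theorem addRange_eq_true {n k : ℕ} {S : Fin n → Bool} {K : Fin k → Fin n} {j : Fin n} :
    addRange S K j = true ↔ S j = true ∨ j ∈ Set.range K := by
  simp [addRange]

/-- The injective `k`-tuples `K` outside `S` for which `G` contains all `k` edges leading from the
vertex `S ∪ K` of the cube down to a vertex `S ∪ K \ {K c}`. -/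
noncomputable def linkTuples {n : ℕ} (G : SimpleGraph (Fin n → Bool)) (S : Fin n → Bool) (k : ℕ) :
    Finset (Fin k → Fin n) := by
  classical
  exact Finset.univ.filter fun K => Function.Injective K ∧
    ∀ c, S (K c) = false ∧ G.Adj (addRange S K) (Function.update (addRange S K) (K c) false)

theorem mem_linkTuples {n k : ℕ} {G : SimpleGraph (Fin n → Bool)} {S : Fin n → Bool}
    {K : Fin k → Fin n} : K ∈ linkTuples G S k ↔ Function.Injective K ∧
      ∀ c, S (K c) = false ∧
        G.Adj (addRange S K) (Function.update (addRange S K) (K c) false) := by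
  simp [linkTuples]

theorem Finset.card_filter_injective_forall_mem {n : ℕ} (k : ℕ) (D : Finset (Fin n))
    [DecidablePred fun K : Fin k → Fin n => Function.Injective K ∧ ∀ c, K c ∈ D] :
    (Finset.univ.filter fun K : Fin k → Fin n => Function.Injective K ∧ ∀ c, K c ∈ D).card =
      D.card.descFactorial k := by
  classical
  have h : Fintype.card (Fin k ↪ D) = D.card.descFactorial k := by
    rw [Fintype.card_embedding_eq, Fintype.card_coe, Fintype.card_fin]
  rw [← h, ← Finset.card_univ, eq_comm]
  refine Finset.card_bij' (fun f _ c => (f c : Fin n))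
    (fun K hK => ⟨fun c => ⟨K c, (Finset.mem_filter.1 hK).2.2 c⟩, fun c d hcd =>
      (Finset.mem_filter.1 hK).2.1 (Subtype.ext_iff.1 hcd)⟩) ?_ ?_ ?_ ?_
  · intro f _
    simp only [Finset.mem_filter, Finset.mem_univ, true_and]
    exact ⟨fun c d hcd => f.injective (Subtype.ext hcd), fun c => (f c).2⟩
  · intro K _; exact Finset.mem_univ _
  · intro f _; ext; rfl
  · intro K _; rfl

/-- A subgraph of the cube with a positive proportion of the edges has a positive density of
link tuples at some vertex `S`. Indeed a positive proportion of the pairs `(T, K)` of a vertex and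
a `k`-tuple satisfies `K ⊆ downDirections G T`, and `(T, K) ↦ (T \ K, K)` is injective. -/
theorem exists_linkTuples_dense (k : ℕ) {ε : ℝ} (hε : 0 < ε) :
    ∃ N : ℕ, ∀ n ≥ N, ∀ G : SimpleGraph (Fin n → Bool), G ≤ cube n →
      ε * (cube n).edgeSet.ncard ≤ G.edgeSet.ncard →
      ∃ S, ε / 4 * (ε / 8) ^ k * (n : ℝ) ^ k ≤ (linkTuples G S k).card := by
  classical
  obtain ⟨N, hN⟩ := exists_nat_gt (8 * k / ε)
  refine ⟨max N 1, fun n hn G hG he => ?_⟩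
  have hn1 : 1 ≤ n := (le_max_right _ _).trans hn
  have hn0 : (0 : ℝ) < n := by exact_mod_cast hn1
  have hnk : (k : ℝ) ≤ ε / 8 * n := by
    have : (N : ℝ) ≤ n := by exact_mod_cast (le_max_left _ _).trans hn
    have := hN.trans_le this
    rw [div_lt_iff₀ hε] at this
    linarith
  have hcube : (2 : ℝ) * (cube n).edgeSet.ncard = n * 2 ^ n := by
    exact_mod_cast two_mul_ncard_edgeSet_cube n
  have hT := Finset.mul_card_le_card_filter_of_le_sum (Finset.univ : Finset (Fin n → Bool))
    (fun T => ((downDirections G T).card : ℝ)) (B := n) (δ := ε / 4) hn0 (by positivity)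
    (fun T _ => by
      have := Finset.card_le_univ (downDirections G T)
      rw [Fintype.card_fin] at this
      exact_mod_cast this)
    (by
      have h1 : ∑ T, ((downDirections G T).card : ℝ) = G.edgeSet.ncard := by
        exact_mod_cast sum_card_downDirections hG
      rw [h1]
      refine le_trans (le_of_eq ?_) he
      rw [Finset.card_univ, Fintype.card_fun, Fintype.card_fin, Fintype.card_bool]
      push_cast
      linear_combination -(ε / 2) * hcube)
  set H := Finset.univ.filter fun T => ε / 4 * n ≤ ((downDirections G T).card : ℝ)
  rw [Finset.card_univ, Fintype.card_fun, Fintype.card_fin, Fintype.card_bool] at hT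
  push_cast at hT
  let P : Finset (Σ _ : Fin n → Bool, Fin k → Fin n) := H.sigma fun T =>
    Finset.univ.filter fun K => Function.Injective K ∧ ∀ c, K c ∈ downDirections G T
  have hP : ε / 4 * 2 ^ n * ((ε / 8) * n) ^ k ≤ (P.card : ℝ) := by
    rw [Finset.card_sigma, Nat.cast_sum]
    refine le_trans (mul_le_mul_of_nonneg_right hT (by positivity)) ?_
    rw [← nsmul_eq_mul]
    refine Finset.card_nsmul_le_sum _ _ _ fun T hTH => ?_
    have hd : ε / 4 * n ≤ ((downDirections G T).card : ℝ) := (Finset.mem_filter.1 hTH).2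
    rw [Finset.card_filter_injective_forall_mem]
    have h1 : ε / 8 * n ≤ (((downDirections G T).card + 1 - k : ℕ) : ℝ) := by
      rw [Nat.cast_sub]
      · push_cast; linarith
      · have : (k : ℝ) ≤ (downDirections G T).card := by
          have : 0 ≤ ε / 8 * n := by positivity
          linarith
        have : k ≤ (downDirections G T).card := by exact_mod_cast this
        omega
    calc (ε / 8 * (n : ℝ)) ^ k ≤ (((downDirections G T).card + 1 - k : ℕ) : ℝ) ^ k := by gcongr
      _ ≤ _ := by exact_mod_cast Nat.pow_sub_le_descFactorial _ _
  -- `base (T, K)` is `T \ K`.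
  let base : (Σ _ : Fin n → Bool, Fin k → Fin n) → Fin n → Bool := fun p j =>
    p.1 j && !decide (j ∈ Set.range p.2)
  have hbase : ∀ p ∈ P, addRange (base p) p.2 = p.1 := by
    intro p hp
    replace hp := Finset.mem_sigma.1 hp
    have hp2 := (Finset.mem_filter.1 hp.2).2
    funext j
    by_cases hj : j ∈ Set.range p.2
    · obtain ⟨c, rfl⟩ := hj
      have := (mem_downDirections.1 (hp2.2 c)).1
      rw [this, addRange_eq_true]
      exact Or.inr ⟨c, rfl⟩
    · simp only [base, addRange, hj, decide_false, Bool.not_false, Bool.and_true, Bool.or_false]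
  obtain ⟨S, -, hS⟩ := Finset.exists_card_fiber_ge P Finset.univ base
    (fun _ _ => Finset.mem_univ _) Finset.univ_nonempty
  rw [Finset.card_univ, Fintype.card_fun, Fintype.card_fin, Fintype.card_bool] at hS
  push_cast at hS
  refine ⟨S, ?_⟩
  have h2 : ((P.filter fun p => base p = S).card : ℝ) ≤ (linkTuples G S k).card := by
    norm_cast
    refine Finset.card_le_card_of_injOn (fun p => p.2) ?_ ?_
    · intro p hp
      obtain ⟨hpP, rfl⟩ := Finset.mem_filter.1 hp
      have hb := hbase p hpP
      replace hp := Finset.mem_sigma.1 hpP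
      have hp2 := (Finset.mem_filter.1 hp.2).2
      refine mem_linkTuples.2 ⟨hp2.1, fun c => ⟨?_, ?_⟩⟩
      · simp [base]
      · rw [hb]; exact (mem_downDirections.1 (hp2.2 c)).2
    · intro p hp q hq hpq
      obtain ⟨hp, hpS⟩ := Finset.mem_filter.1 hp
      obtain ⟨hq, hqS⟩ := Finset.mem_filter.1 hq
      have e1 := hbase p hp
      have e2 := hbase q hq
      dsimp only at hpq
      rw [hpS, hpq] at e1
      rw [hqS] at e2
      exact Sigma.ext (e1.symm.trans e2) (heq_of_eq hpq)
  refine le_trans ?_ (hS.trans h2)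
  rw [le_div_iff₀ (by positivity)]
  refine le_trans (le_of_eq ?_) hP
  ring

/-! ### Partite representations and extremal numbers -/

/-- A box of link tuples of `G` at `S` contains every graph with a `k`-partite representation in
`Q_l`: a coordinate `x : Fin l` is sent to the element numbered `x` of the side of the box selected
by `σ x`. -/
theorem isContained_of_box {k l n : ℕ} {W : Type*} {A : SimpleGraph W} {𝓗 : Set (Set (Fin l))}
    (hA : IsPartiteRepresentation k A 𝓗) {G : SimpleGraph (Fin n → Bool)} {S : Fin n → Bool}
    {a : Fin k → Fin l → Fin n} (ha : ∀ i, Function.Injective (a i))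
    (haF : ∀ f : Fin k → Fin l, (fun i => a i (f i)) ∈ linkTuples G S k) :
    A.IsContained G := by
  classical
  obtain ⟨H, ⟨φ⟩, ⟨hcard, σ, hσ⟩, -⟩ := hA
  let ψ : Fin l → Fin n := fun x => a (σ x) x
  have hψS : ∀ x, S (ψ x) = false := fun x => ((mem_linkTuples.1 (haF fun _ => x)).2 (σ x)).1
  have hψ : Function.Injective ψ := by
    intro x y hxy
    by_cases h : σ x = σ y
    · apply ha (σ x); simpa only [ψ, ← h] using hxy
    · have hinj := (mem_linkTuples.1 (haF fun i => if i = σ x then x else y)).1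
      refine absurd (hinj ?_ : σ x = σ y) h
      simpa [Ne.symm h] using hxy
  let Ψ : (Fin l → Bool) → Fin n → Bool := fun v j => S j || decide (∃ x, ψ x = j ∧ v x = true)
  have hΨψ : ∀ v x, Ψ v (ψ x) = v x := by
    intro v x
    simp [Ψ, hψS, hψ.eq_iff]
  have hΨ : Function.Injective Ψ := fun u v h => funext fun x => by
    rw [← hΨψ u, ← hΨψ v, h]
  have hdown : ∀ u i, u i = true → H.Adj u (Function.update u i false) →
      G.Adj (Ψ u) (Ψ (Function.update u i false)) := by
    intro u i hi hadj
    have he : s(u, Function.update u i false) ∈ H.edgeSet := hadj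
    have hbits : nonzeroBits s(u, Function.update u i false) = {x | u x = true} := by
      ext x
      simp only [nonzeroBits, Sym2.mem_iff, exists_eq_or_imp, exists_eq_left, Set.mem_ofPred_eq,
        Function.update_apply]
      split_ifs <;> simp
    have hσu := hσ _ he
    have hcu := hcard _ he
    rw [hbits] at hσu hcu
    -- `σ` maps the `k` ones of `u` onto `[k]`, hence bijectively; `f` is the inverse.
    have hinj : Set.InjOn σ {x | u x = true} := by
      rw [← Set.ncard_image_iff, hσu, hcu, Set.ncard_univ, Nat.card_fin]
    have hsurj : ∀ c, ∃ x, u x = true ∧ σ x = c := fun c => by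
      have : c ∈ σ '' {x | u x = true} := by rw [hσu]; trivial
      exact this
    choose f hfu hfσ using hsurj
    have hf : ∀ x, u x = true → f (σ x) = x := fun x hx => hinj (hfu _) hx (hfσ _)
    have hK := mem_linkTuples.1 (haF f)
    have htop : addRange S (fun c => a c (f c)) = Ψ u := by
      funext j
      rw [Bool.eq_iff_iff, addRange_eq_true]
      simp only [Ψ, Bool.or_eq_true, decide_eq_true_eq, Set.mem_range]
      refine or_congr_right ⟨?_, ?_⟩
      · rintro ⟨c, rfl⟩
        exact ⟨f c, by simp only [ψ, hfσ], hfu c⟩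
      · rintro ⟨x, rfl, hx⟩
        exact ⟨σ x, by simp only [ψ, hf x hx]⟩
    have h := (hK.2 (σ i)).2
    rw [htop] at h
    convert h using 1
    have hi' : a (σ i) (f (σ i)) = ψ i := by rw [hf i hi]
    rw [hi']
    funext j
    by_cases hj : j = ψ i
    · subst hj
      rw [hΨψ]; simp
    · rw [Function.update_of_ne hj]
      simp only [Ψ]
      congr 1
      refine decide_eq_decide.2 (exists_congr fun x => and_congr_right fun hx => ?_)
      rw [Function.update_of_ne]
      rintro rfl
      exact hj hx.symm
  have hadj : ∀ {u v}, H.Adj u v → G.Adj (Ψ u) (Ψ v) := by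
    intro u v h
    rcases cube_adj_iff.1 h.adj_sub with ⟨i, hi, rfl⟩ | ⟨i, hi, rfl⟩
    · exact hdown _ i hi h
    · exact (hdown _ i hi h.symm).symm
  let g : H.coe →g G := ⟨fun v => Ψ v, fun h => hadj h⟩
  have hg : Function.Injective g := hΨ.comp Subtype.val_injective
  exact ⟨⟨g.comp φ.toHom, hg.comp φ.injective⟩⟩

/-- Conlon's criterion: a graph with a `k`-partite representation has extremal number `o(e(Q_n))`
in the hypercube. -/
theorem IsPartiteRepresentation.relativeEx_isLittleO {k l : ℕ} {W : Type*} {A : SimpleGraph W}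
    {𝓗 : Set (Set (Fin l))} (hA : IsPartiteRepresentation k A 𝓗) :
    (fun n : ℕ => (relativeEx (cube n) A : ℝ))
      =o[atTop] (fun n : ℕ => ((cube n).edgeSet.ncard : ℝ)) := by
  rw [isLittleO_iff]
  intro ε hε
  obtain ⟨N, hN⟩ := exists_linkTuples_dense k hε
  obtain ⟨M, hM⟩ := exists_box_of_dense k l (c := ε / 4 * (ε / 8) ^ k) (by positivity)
  filter_upwards [eventually_ge_atTop (max N M)] with n hn
  rw [Real.norm_natCast, Real.norm_natCast]
  have key : ∀ m ∈ {m : ℕ | ∃ G' : SimpleGraph (Fin n → Bool),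
      G' ≤ cube n ∧ A.Free G' ∧ G'.edgeSet.ncard = m}, (m : ℝ) ≤ ε * (cube n).edgeSet.ncard := by
    rintro m ⟨G, hG, hfree, rfl⟩
    by_contra! hlt
    obtain ⟨S, hS⟩ := hN n ((le_max_left _ _).trans hn) G hG hlt.le
    obtain ⟨a, ha, haF⟩ := hM n ((le_max_right _ _).trans hn) _ hS
    exact hfree (isContained_of_box hA ha haF)
  rcases Set.eq_empty_or_nonempty {m : ℕ | ∃ G' : SimpleGraph (Fin n → Bool),
      G' ≤ cube n ∧ A.Free G' ∧ G'.edgeSet.ncard = m} with h | h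
  · rw [relativeEx, h, csSup_empty, bot_eq_zero, Nat.cast_zero]
    positivity
  · have := csSup_le h fun m hm => Nat.le_floor (key m hm)
    exact (Nat.le_floor_iff (by positivity)).1 this

/-! ### Representations of even cycles -/

/-- The elements of `Fin t` whose value lies in `s`. -/
def valSet (t : ℕ) (s : Finset ℕ) : Set (Fin t) := {v | (v : ℕ) ∈ s}

theorem valSet_mono {t : ℕ} {s s' : Finset ℕ} (h : s ⊆ s') : valSet t s ⊆ valSet t s' :=
  fun _ hv => h hv

theorem valSet_injOn (t : ℕ) :
    Set.InjOn (valSet t) {s | ∀ x ∈ s, x < t} := by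
  have key : ∀ {s s' : Finset ℕ}, (∀ x ∈ s, x < t) → valSet t s = valSet t s' → s ⊆ s' := by
    intro s s' hs h x hx
    have h1 : (⟨x, hs x hx⟩ : Fin t) ∈ valSet t s := hx
    rw [h] at h1
    exact h1
  exact fun s hs s' hs' h => Finset.Subset.antisymm (key hs h) (key hs' h.symm)

theorem ncard_valSet {t : ℕ} {s : Finset ℕ} (hs : ∀ x ∈ s, x < t) :
    (valSet t s).ncard = s.card := by
  rw [← Set.ncard_coe_finset s, ← Set.ncard_image_of_injective _ Fin.val_injective]
  congr 1
  ext x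
  constructor
  · rintro ⟨v, hv, rfl⟩; exact hv
  · intro hx; exact ⟨⟨x, hs x hx⟩, hx, rfl⟩

/-- The vertex of the cube with set of ones `A`. -/
noncomputable def indicatorVertex {l : ℕ} (A : Set (Fin l)) : Fin l → Bool := by
  classical
  exact fun j => decide (j ∈ A)

theorem indicatorVertex_eq_true {l : ℕ} {A : Set (Fin l)} {j : Fin l} :
    indicatorVertex A j = true ↔ j ∈ A := by
  simp [indicatorVertex]

theorem indicatorVertex_injective {l : ℕ} :
    Function.Injective (indicatorVertex : Set (Fin l) → Fin l → Bool) := fun A B h => by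
  ext j
  rw [← indicatorVertex_eq_true, h, indicatorVertex_eq_true]

theorem nonzeroBits_indicatorVertex {l : ℕ} {A B : Set (Fin l)} (h : A ⊆ B) :
    nonzeroBits s(indicatorVertex B, indicatorVertex A) = B := by
  ext x
  simp only [nonzeroBits, Sym2.mem_iff, exists_eq_or_imp, exists_eq_left, Set.mem_ofPred_eq,
    indicatorVertex_eq_true]
  exact ⟨fun h' => h'.elim id fun hx => h hx, Or.inl⟩

theorem cube_adj_indicatorVertex {l : ℕ} {A B : Set (Fin l)} (h : A ⊆ B)
    (hc : B.ncard = A.ncard + 1) : (cube l).Adj (indicatorVertex B) (indicatorVertex A) := by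
  obtain ⟨x, hx, rfl⟩ := (Set.exists_eq_insert_iff_ncard).2 ⟨h, hc.symm⟩
  refine cube_adj_iff.2 (Or.inl ⟨x, by simp [indicatorVertex], ?_⟩)
  funext j
  by_cases hj : j = x
  · subst hj
    simp [indicatorVertex, hx]
  · simp [indicatorVertex, hj]

theorem cycleGraph_adj_iff_val {N : ℕ} (hN : 2 ≤ N) {u v : Fin N} :
    (SimpleGraph.cycleGraph N).Adj u v ↔
      ((v : ℕ) = u + 1 ∨ ((u : ℕ) + 1 = N ∧ (v : ℕ) = 0)) ∨
        ((u : ℕ) = v + 1 ∨ ((v : ℕ) + 1 = N ∧ (u : ℕ) = 0)) := by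
  rw [SimpleGraph.cycleGraph_adj']
  have hu := u.2
  have hv := v.2
  rcases lt_trichotomy u v with h | h | h
  · have h1 := Fin.coe_sub_iff_lt.2 h
    have h2 := Fin.coe_sub_iff_le.2 h.le
    have : (u : ℕ) < v := h
    omega
  · have h2 := Fin.coe_sub_iff_le.2 h.le
    have h3 := Fin.coe_sub_iff_le.2 h.ge
    have : (u : ℕ) = v := by rw [h]
    omega
  · have h1 := Fin.coe_sub_iff_lt.2 h
    have h2 := Fin.coe_sub_iff_le.2 h.le
    have : (v : ℕ) < u := h
    omega

/-- A cyclic sequence of sets `T 0, P 0, T 1, P 1, …, T (t - 1), P (t - 1)` in which every `P i` is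
contained in its two neighbours is a copy of the cycle `C_{2t}` between two layers of the cube. It
is a partite representation with edges `T i` if the residues modulo `k + 1` colour every `T i`
completely. -/
theorem isPartiteRepresentation_cycleGraph {k t : ℕ} (ht : 2 ≤ t) {T P : ℕ → Finset ℕ}
    (hTt : ∀ i < t, ∀ x ∈ T i, x < t)
    (hTinj : ∀ i < t, ∀ j < t, T i = T j → i = j) (hPinj : ∀ i < t, ∀ j < t, P i = P j → i = j)
    (hTc : ∀ i < t, (T i).card = k + 1) (hPc : ∀ i < t, (P i).card = k)
    (hPT : ∀ i < t, P i ⊆ T i) (hPT' : ∀ i, i + 1 < t → P i ⊆ T (i + 1))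
    (hPT0 : P (t - 1) ⊆ T 0)
    (hσ : ∀ i < t, ∀ c < k + 1, ∃ x ∈ T i, x % (k + 1) = c) :
    IsPartiteRepresentation (k + 1) (SimpleGraph.cycleGraph (2 * t))
      ((fun i => valSet t (T i)) '' Set.Iio t) := by
  have hPt : ∀ i < t, ∀ x ∈ P i, x < t := fun i hi x hx => hTt i hi x (hPT i hi hx)
  let f : ℕ → Fin t → Bool := fun u =>
    indicatorVertex (valSet t (if u % 2 = 0 then T (u / 2) else P (u / 2)))
  have hfT : ∀ m, f (2 * m) = indicatorVertex (valSet t (T m)) := fun m => by simp [f]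
  have hfP : ∀ m, f (2 * m + 1) = indicatorVertex (valSet t (P m)) := fun m => by
    simp only [f]
    rw [if_neg (by omega), show (2 * m + 1) / 2 = m by omega]
  have hTP : ∀ i < t, ∀ j < t, P j ⊆ T i →
      (cube t).Adj (indicatorVertex (valSet t (T i))) (indicatorVertex (valSet t (P j))) := by
    intro i hi j hj h
    refine cube_adj_indicatorVertex (valSet_mono h) ?_
    rw [ncard_valSet (hTt i hi), ncard_valSet (hPt j hj), hTc i hi, hPc j hj]
  have hstep : ∀ u v : Fin (2 * t), (SimpleGraph.cycleGraph (2 * t)).Adj u v →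
      ∃ i < t, ∃ j < t, P j ⊆ T i ∧
        s(f u, f v) = s(indicatorVertex (valSet t (T i)), indicatorVertex (valSet t (P j))) := by
    have hdir : ∀ u v : ℕ, u < 2 * t → v < 2 * t → (v = u + 1 ∨ (u + 1 = 2 * t ∧ v = 0)) →
        ∃ i < t, ∃ j < t, P j ⊆ T i ∧
        s(f u, f v) = s(indicatorVertex (valSet t (T i)), indicatorVertex (valSet t (P j))) := by
      intro u v hu hv huv
      obtain ⟨m, rfl | rfl⟩ : ∃ m, u = 2 * m ∨ u = 2 * m + 1 := ⟨u / 2, by omega⟩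
      · obtain rfl : v = 2 * m + 1 := by omega
        exact ⟨m, by omega, m, by omega, hPT m (by omega), by rw [hfT, hfP]⟩
      · rcases huv with rfl | ⟨hm, rfl⟩
        · refine ⟨m + 1, by omega, m, by omega, hPT' m (by omega), ?_⟩
          rw [hfP, show 2 * m + 1 + 1 = 2 * (m + 1) by ring, hfT, Sym2.eq_swap]
        · obtain rfl : m = t - 1 := by omega
          refine ⟨0, by omega, t - 1, by omega, hPT0, ?_⟩
          rw [hfP, show (0 : ℕ) = 2 * 0 by rfl, hfT, Sym2.eq_swap]
    intro u v huv
    rcases (cycleGraph_adj_iff_val (by omega)).1 huv with h | h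
    · exact hdir u v u.2 v.2 h
    · rw [Sym2.eq_swap]
      exact hdir v u v.2 u.2 h
  let g : SimpleGraph.cycleGraph (2 * t) →g cube t := ⟨fun u => f u, fun {u v} huv => by
    obtain ⟨i, hi, j, hj, hji, h⟩ := hstep u v huv
    have := hTP i hi j hj hji
    rw [← SimpleGraph.mem_edgeSet] at this ⊢
    rwa [h]⟩
  have hg : Function.Injective g := by
    intro u v huv
    have hs : ∀ w : Fin (2 * t),
        ∀ x ∈ (if (w : ℕ) % 2 = 0 then T (w / 2) else P (w / 2)), x < t := by
      intro w
      have := w.2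
      split_ifs
      · exact hTt _ (by omega)
      · exact hPt _ (by omega)
    have h := valSet_injOn t (hs u) (hs v) (indicatorVertex_injective huv)
    -- The two layers are separated by the cardinalities of the sets.
    have hc : ∀ i < t, ∀ j < t, T i ≠ P j := fun i hi j hj h => by
      have h1 := hTc i hi
      rw [h, hPc j hj] at h1
      omega
    have hu := u.2
    have hv := v.2
    apply Fin.ext
    split_ifs at h
    · have := hTinj _ (by omega) _ (by omega) h; omega
    · exact absurd h (hc _ (by omega) _ (by omega))
    · exact absurd h.symm (hc _ (by omega) _ (by omega))
    · have := hPinj _ (by omega) _ (by omega) h; omega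
  let C : SimpleGraph.Copy (SimpleGraph.cycleGraph (2 * t)) (cube t) := ⟨g, hg⟩
  have hmem : ∀ e ∈ C.toSubgraph.edgeSet, ∃ i < t, nonzeroBits e = valSet t (T i) := by
    intro e he
    rw [SimpleGraph.Subgraph.edgeSet_map] at he
    obtain ⟨e', he', rfl⟩ := he
    induction e' with
    | h u v =>
      obtain ⟨i, hi, j, hj, hji, h⟩ := hstep u v (by simpa using he')
      refine ⟨i, hi, ?_⟩
      change nonzeroBits s(f u, f v) = _
      rw [h, nonzeroBits_indicatorVertex (valSet_mono hji)]
  refine ⟨C.toSubgraph, ⟨C.isoToSubgraph⟩, ⟨fun e he => ?_, fun x => Fin.ofNat (k + 1) x,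
    fun e he => ?_⟩, ?_⟩
  · obtain ⟨i, hi, h⟩ := hmem e he
    rw [h, ncard_valSet (hTt i hi), hTc i hi]
  · obtain ⟨i, hi, h⟩ := hmem e he
    rw [h, Set.eq_univ_iff_forall]
    intro c
    obtain ⟨x, hx, hxc⟩ := hσ i hi c c.2
    exact ⟨⟨x, hTt i hi x hx⟩, hx, Fin.ext hxc⟩
  · ext s
    constructor
    · rintro ⟨e, he, rfl⟩
      obtain ⟨i, hi, h⟩ := hmem e he
      exact ⟨i, hi, h.symm⟩
    · rintro ⟨i, hi, rfl⟩
      have hi : i < t := hi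
      refine ⟨s(f (2 * i), f (2 * i + 1)), ?_, ?_⟩
      · rw [SimpleGraph.Subgraph.edgeSet_map]
        refine ⟨s(⟨2 * i, by omega⟩, ⟨2 * i + 1, by omega⟩), ?_, rfl⟩
        rw [SimpleGraph.Subgraph.mem_edgeSet, SimpleGraph.Subgraph.top_adj,
          cycleGraph_adj_iff_val (by omega)]
        exact Or.inl (Or.inl rfl)
      · rw [hfT, hfP, nonzeroBits_indicatorVertex (valSet_mono (hPT i hi))]

theorem pair_eq_of_lt {a b a' b' : ℕ} (h : ({a, b} : Finset ℕ) = {a', b'}) (hab : a < b)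
    (hab' : a' < b') : a = a' ∧ b = b' := by
  have h1 : a ∈ ({a', b'} : Finset ℕ) := h ▸ by simp
  have h2 : b ∈ ({a', b'} : Finset ℕ) := h ▸ by simp
  simp only [Finset.mem_insert, Finset.mem_singleton] at h1 h2
  omega

theorem triple_eq_of_lt {a b c a' b' c' : ℕ} (h : ({a, b, c} : Finset ℕ) = {a', b', c'})
    (hab : a < b) (hbc : b < c) (hab' : a' < b') (hbc' : b' < c') :
    a = a' ∧ b = b' ∧ c = c' := by
  have h1 : a ∈ ({a', b', c'} : Finset ℕ) := h ▸ by simp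
  have h2 : b ∈ ({a', b', c'} : Finset ℕ) := h ▸ by simp
  have h3 : c ∈ ({a', b', c'} : Finset ℕ) := h ▸ by simp
  simp only [Finset.mem_insert, Finset.mem_singleton] at h1 h2 h3
  omega

theorem card_triple_of_lt {a b c : ℕ} (hab : a < b) (hbc : b < c) :
    ({a, b, c} : Finset ℕ).card = 3 :=
  Finset.card_eq_three.2 ⟨a, b, c, by omega, by omega, by omega, rfl⟩

/-- The successor of `i` modulo `t`, for `i < t`. -/
def cyclicSucc (t i : ℕ) : ℕ := if i + 1 = t then 0 else i + 1

theorem cyclicSucc_spec (t i : ℕ) :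
    (i + 1 = t ∧ cyclicSucc t i = 0) ∨ (i + 1 ≠ t ∧ cyclicSucc t i = i + 1) := by
  unfold cyclicSucc
  split_ifs <;> omega

theorem isPartiteRepresentation_two_cycleGraph {t : ℕ} (ht : 4 ≤ t) (heven : Even t) :
    IsPartiteRepresentation 2 (SimpleGraph.cycleGraph (2 * t))
      (graphHypergraph (SimpleGraph.cycleGraph t)) := by
  obtain ⟨r, hr⟩ := heven
  have hT : ∀ i < t, ∀ j < t, ({i, cyclicSucc t i} : Finset ℕ) = {j, cyclicSucc t j} → i = j := by
    intro i hi j hj h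
    have h1 : i ∈ ({j, cyclicSucc t j} : Finset ℕ) := h ▸ by simp
    have h2 : cyclicSucc t i ∈ ({j, cyclicSucc t j} : Finset ℕ) := h ▸ by simp
    simp only [Finset.mem_insert, Finset.mem_singleton] at h1 h2
    have hi' := cyclicSucc_spec t i
    have hj' := cyclicSucc_spec t j
    omega
  have h := isPartiteRepresentation_cycleGraph (k := 1) (t := t) (by omega)
    (T := fun i => {i, cyclicSucc t i}) (P := fun i => {cyclicSucc t i}) ?_ hT ?_ ?_ ?_ ?_ ?_ ?_ ?_
  · convert h using 1
    ext s
    constructor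
    · rintro ⟨u, v, huv, rfl⟩
      have key : ∀ u v : Fin t, ((v : ℕ) = u + 1 ∨ ((u : ℕ) + 1 = t ∧ (v : ℕ) = 0)) →
          valSet t {(u : ℕ), cyclicSucc t u} = {u, v} := by
        intro u v h
        have : cyclicSucc t u = v := by
          have := v.2
          unfold cyclicSucc; split_ifs <;> omega
        ext x
        simp [valSet, this, Fin.ext_iff]
      rcases (cycleGraph_adj_iff_val (by omega)).1 huv with h | h
      · exact ⟨u, u.2, key u v h⟩
      · rw [Set.pair_comm]
        exact ⟨v, v.2, key v u h⟩
    · rintro ⟨i, hi, rfl⟩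
      have hi : i < t := hi
      have hi' : cyclicSucc t i < t := by unfold cyclicSucc; split_ifs <;> omega
      refine ⟨⟨i, hi⟩, ⟨cyclicSucc t i, hi'⟩, ?_, ?_⟩
      · rw [cycleGraph_adj_iff_val (by omega)]
        left
        simp only [cyclicSucc]
        split_ifs <;> omega
      · ext x
        simp [valSet, Fin.ext_iff]
  · intro i hi x hx
    simp only [Finset.mem_insert, Finset.mem_singleton, cyclicSucc] at hx
    split_ifs at hx <;> omega
  · intro i hi j hj h
    have h := Finset.singleton_injective h
    simp only [cyclicSucc] at h
    split_ifs at h <;> omega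
  · intro i hi
    refine Finset.card_pair ?_
    simp only [cyclicSucc]
    split_ifs <;> omega
  · intro i hi
    simp
  · intro i hi x hx
    simp_all
  · intro i hi x hx
    simp only [Finset.mem_singleton, cyclicSucc, if_neg hi.ne] at hx
    simp [hx]
  · intro x hx
    simp only [Finset.mem_singleton, cyclicSucc, if_pos (show t - 1 + 1 = t by omega)] at hx
    simp [hx]
  · intro i hi c hc
    simp only [Finset.mem_insert, Finset.mem_singleton, exists_eq_or_imp, exists_eq_left,
      cyclicSucc]
    split_ifs <;> omega

/-! ### Nearly tight cycles -/

/-- For `i < t - 2` the triple `{i, i + 1, i + 2}`; the last two triples are `{p, q, t - 1}` and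
`{0, 1, s}`. -/
def nearlyTight (t p q s i : ℕ) : Finset ℕ :=
  {if i + 2 < t then i else if i + 1 < t then p else 0,
    if i + 2 < t then i + 1 else if i + 1 < t then q else 1,
    if i + 2 < t then i + 2 else if i + 1 < t then t - 1 else s}

/-- The intersection of the triples `nearlyTight t p q s i` and `nearlyTight t p q s (i + 1)`. -/
def nearlyTightPair (t p q s i : ℕ) : Finset ℕ :=
  {if i + 3 < t then i + 1 else if i + 2 < t then q else if i + 1 < t then p else 0,
    if i + 3 < t then i + 2 else if i + 2 < t then t - 1 else if i + 1 < t then s else 1}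

theorem nearlyTight_injective {t p q s : ℕ} (ht : 7 ≤ t) (hp : p ≤ 1)
    (hqt : q = t - 2 ∨ q = t - 3) (hs : t ≤ s + 3) :
    ∀ i < t, ∀ j < t, nearlyTight t p q s i = nearlyTight t p q s j → i = j := by
  intro i hi j hj h
  obtain ⟨h1, h2, h3⟩ := triple_eq_of_lt h (by split_ifs <;> omega) (by split_ifs <;> omega)
    (by split_ifs <;> omega) (by split_ifs <;> omega)
  split_ifs at h1 h2 h3 <;> omega

/-- The conditions on `p`, `q`, `s` say that the residues modulo `3` colour the last two triples
properly, and that `{p, s}` is contained in `{p, q, t - 1}`. -/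
theorem isPartiteRepresentation_nearlyTight {t p q s : ℕ} (ht : 7 ≤ t) (hp : p ≤ 1)
    (hqt : q = t - 2 ∨ q = t - 3) (hs : t ≤ s + 3) (hsq : s = q ∨ s + 1 = t)
    (hX : ∀ c < 3, p % 3 = c ∨ q % 3 = c ∨ (t - 1) % 3 = c) (hY : s % 3 = 2) :
    IsPartiteRepresentation 3 (SimpleGraph.cycleGraph (2 * t))
      ((fun i => valSet t (nearlyTight t p q s i)) '' Set.Iio t) := by
  refine isPartiteRepresentation_cycleGraph (k := 2) (P := nearlyTightPair t p q s) (by omega) ?_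
    (nearlyTight_injective ht hp hqt hs) ?_ ?_ ?_ ?_ ?_ ?_ ?_
  · intro i hi x hx
    simp only [nearlyTight, Finset.mem_insert, Finset.mem_singleton] at hx
    split_ifs at hx <;> omega
  · intro i hi j hj h
    obtain ⟨h1, h2⟩ := pair_eq_of_lt h (by split_ifs <;> omega) (by split_ifs <;> omega)
    split_ifs at h1 h2 <;> omega
  · intro i hi
    exact card_triple_of_lt (by split_ifs <;> omega) (by split_ifs <;> omega)
  · intro i hi
    exact Finset.card_pair (by split_ifs <;> omega)
  · intro i hi x hx
    simp only [nearlyTight, nearlyTightPair, Finset.mem_insert, Finset.mem_singleton] at hx ⊢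
    split_ifs at hx ⊢ <;> omega
  · intro i hi x hx
    simp only [nearlyTight, nearlyTightPair, Finset.mem_insert, Finset.mem_singleton] at hx ⊢
    split_ifs at hx ⊢ <;> omega
  · intro x hx
    simp only [nearlyTight, nearlyTightPair, Finset.mem_insert, Finset.mem_singleton] at hx ⊢
    split_ifs at hx ⊢ <;> omega
  · intro i hi c hc
    have := hX c hc
    simp only [nearlyTight, Finset.mem_insert, Finset.mem_singleton, exists_eq_or_imp,
      exists_eq_left]
    split_ifs <;> omega

theorem tightCycle_eq_image {t : ℕ} : tightCycle t =
    (fun i => valSet t {i, cyclicSucc t i, cyclicSucc t (cyclicSucc t i)}) '' Set.Iio t := by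
  have hrot : ∀ i : Fin t, (finRotate t i : ℕ) = cyclicSucc t i := by
    intro i
    cases t with
    | zero => exact i.elim0
    | succ n =>
      rw [coe_finRotate, cyclicSucc]
      simp [Fin.ext_iff]
  have hset : ∀ i : Fin t, ({i, finRotate t i, finRotate t (finRotate t i)} : Set (Fin t)) =
      valSet t {(i : ℕ), cyclicSucc t i, cyclicSucc t (cyclicSucc t i)} := by
    intro i
    ext x
    simp only [valSet, Set.mem_insert_iff, Set.mem_singleton_iff, Set.mem_ofPred_eq,
      Finset.mem_insert, Finset.mem_singleton, Fin.ext_iff, hrot]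
  ext A
  constructor
  · rintro ⟨i, rfl⟩
    exact ⟨i, i.2, (hset i).symm⟩
  · rintro ⟨i, hi, rfl⟩
    exact ⟨⟨i, hi⟩, hset ⟨i, hi⟩⟩

theorem nearlyTight_eq_of_lt {t p q s i : ℕ} (hi : i + 2 < t) : nearlyTight t p q s i =
    {i, cyclicSucc t i, cyclicSucc t (cyclicSucc t i)} := by
  have h1 : cyclicSucc t i = i + 1 := if_neg (by omega)
  have h2 : cyclicSucc t (i + 1) = i + 2 := if_neg (by omega)
  rw [h1, h2]
  simp [nearlyTight, hi]

theorem nearlyTight_eq_tight {t i : ℕ} (ht : 7 ≤ t) (hi : i < t) :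
    nearlyTight t 0 (t - 2) (t - 1) i =
      {i, cyclicSucc t i, cyclicSucc t (cyclicSucc t i)} := by
  by_cases h : i + 2 < t
  · exact nearlyTight_eq_of_lt h
  ext x
  simp only [nearlyTight, cyclicSucc, Finset.mem_insert, Finset.mem_singleton]
  split_ifs <;> omega

theorem exists_nearly_tight_representation {t p q s : ℕ} (ht : 7 ≤ t) (hp : p ≤ 1)
    (hqt : q = t - 2 ∨ q = t - 3) (hs : t ≤ s + 3) (hsq : s = q ∨ s + 1 = t)
    (hX : ∀ c < 3, p % 3 = c ∨ q % 3 = c ∨ (t - 1) % 3 = c) (hY : s % 3 = 2)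
    (h3 : 3 ∣ t → p = 0 ∧ q = t - 2 ∧ s = t - 1) :
    ∃ 𝓗 : Set (Set (Fin t)),
      IsPartiteRepresentation 3 (SimpleGraph.cycleGraph (2 * t)) 𝓗 ∧ 𝓗.ncard = t ∧
        t ≤ (𝓗 ∩ tightCycle t).ncard + 2 ∧ (3 ∣ t → 𝓗 = tightCycle t) := by
  have hinj : Set.InjOn (fun i => valSet t (nearlyTight t p q s i)) (Set.Iio t) := by
    have hlt : ∀ i < t, ∀ x ∈ nearlyTight t p q s i, x < t := by
      intro i hi x hx
      simp only [nearlyTight, Finset.mem_insert, Finset.mem_singleton] at hx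
      split_ifs at hx <;> omega
    exact fun i hi j hj h => nearlyTight_injective ht hp hqt hs i hi j hj
      (valSet_injOn t (hlt i hi) (hlt j hj) h)
  refine ⟨_, isPartiteRepresentation_nearlyTight ht hp hqt hs hsq hX hY,
    ?_, ?_, fun h => ?_⟩
  · rw [Set.InjOn.ncard_image hinj, Set.ncard_Iio_nat]
  · have hsub : (fun i => valSet t (nearlyTight t p q s i)) '' Set.Iio (t - 2) ⊆
        (fun i => valSet t (nearlyTight t p q s i)) '' Set.Iio t ∩ tightCycle t := by
      rintro _ ⟨i, hi, rfl⟩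
      have hi : i < t - 2 := hi
      have hit : i < t := by omega
      refine ⟨⟨i, hit, rfl⟩, ?_⟩
      rw [tightCycle_eq_image]
      refine ⟨i, hit, ?_⟩
      dsimp only
      rw [nearlyTight_eq_of_lt (by omega)]
    have := Set.ncard_le_ncard hsub
    rw [Set.InjOn.ncard_image (hinj.mono (Set.Iio_subset_Iio (by omega))),
      Set.ncard_Iio_nat] at this
    omega
  · obtain ⟨rfl, rfl, rfl⟩ := h3 h
    rw [tightCycle_eq_image]
    refine Set.image_congr fun i hi => ?_
    rw [nearlyTight_eq_tight ht hi]

/-- The last two triples `{p, q, t - 1}` and `{0, 1, s}` have to close up the path of tight triples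
from `{0, 1, 2}` to `{t - 3, t - 2, t - 1}` compatibly with the colouring by residues modulo `3`, so
they depend on the residue of `t`. -/
theorem exists_three_partite_representation {t : ℕ} (ht : 7 ≤ t) :
    ∃ 𝓗 : Set (Set (Fin t)),
      IsPartiteRepresentation 3 (SimpleGraph.cycleGraph (2 * t)) 𝓗 ∧ 𝓗.ncard = t ∧
        t ≤ (𝓗 ∩ tightCycle t).ncard + 2 ∧ (3 ∣ t → 𝓗 = tightCycle t) := by
  obtain h | h | h : t % 3 = 0 ∨ t % 3 = 1 ∨ t % 3 = 2 := by omega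
  · exact exists_nearly_tight_representation (p := 0) (q := t - 2) (s := t - 1) ht
      (by omega) (by omega) (by omega) (by omega) (by omega) (by omega) (by omega)
  · exact exists_nearly_tight_representation (p := 1) (q := t - 2) (s := t - 2) ht
      (by omega) (by omega) (by omega) (by omega) (by omega) (by omega) (by omega)
  · exact exists_nearly_tight_representation (p := 0) (q := t - 3) (s := t - 3) ht
      (by omega) (by omega) (by omega) (by omega) (by omega) (by omega) (by omega)

theorem mainTheorem4 :
    (∀ t : ℕ, 4 ≤ t → t ≠ 5 →
      (fun n : ℕ => (relativeEx (cube n) (SimpleGraph.cycleGraph (2 * t)) : ℝ))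
        =o[atTop] (fun n : ℕ => ((cube n).edgeSet.ncard : ℝ))) ∧
    (∀ t : ℕ, 4 ≤ t → Even t →
      IsPartiteRepresentation 2 (SimpleGraph.cycleGraph (2 * t))
        (graphHypergraph (SimpleGraph.cycleGraph t))) ∧
    (∀ t : ℕ, 7 ≤ t → Odd t →
      ∃ 𝓗 : Set (Set (Fin t)),
        IsPartiteRepresentation 3 (SimpleGraph.cycleGraph (2 * t)) 𝓗 ∧
        𝓗.ncard = t ∧
        t ≤ (𝓗 ∩ tightCycle t).ncard + 2 ∧
        (3 ∣ t → 𝓗 = tightCycle t)) := by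
  refine ⟨fun t ht ht5 => ?_, fun t ht heven => isPartiteRepresentation_two_cycleGraph ht heven,
    fun t ht _ => exists_three_partite_representation ht⟩
  rcases Nat.even_or_odd t with heven | ⟨r, hr⟩
  · exact (isPartiteRepresentation_two_cycleGraph ht heven).relativeEx_isLittleO
  · obtain ⟨𝓗, h, -⟩ := exists_three_partite_representation (t := t) (by omega)
    exact h.relativeEx_isLittleO
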